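/- For every constant $c>0$ there is a constant $\delta>0$, depending only on $c$, such that the following holds. Let $w$ and $N$ be integers with $0<w<2w\le N$ and $N\ge 2^{cw}$. Let $R_x=[2w,N]\times[0,w]$ and $R_y=[0,w]\times[2w,N]$ be rectangles in the plane, and let $L=R_x\cup R_y$. Let $p(x,y)$ be a real polynomial of (total) degree $d$ such that 1. $p(2w,2w)\ge 2$, and 2. $0\le p(x,y)\le 1$ for all $(x,y)\in L\cap\mathbb{Z}^2$. Then $d\ge \delta w$. (In asymptotic notation: if $N=2^{\Omega(w)}$, then $d=\Omega(w)$.) -/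

import Mathlib

/-- The rectangle `R_x = [2w, N] × [0, w]` in the plane. -/
def rectX (w N : ℝ) : Set (ℝ × ℝ) := Set.Icc (2 * w) N ×ˢ Set.Icc 0 w

/-- The rectangle `R_y = [0, w] × [2w, N]` in the plane. -/
def rectY (w N : ℝ) : Set (ℝ × ℝ) := Set.Icc 0 w ×ˢ Set.Icc (2 * w) N

/-- The L-shaped region `L = R_x ∪ R_y`. -/
def regionL (w N : ℝ) : Set (ℝ × ℝ) := rectX w N ∪ rectY w N

/-- The value `p(x, y)` of a real bivariate polynomial. -/
noncomputable def evalXY (p : MvPolynomial (Fin 2) ℝ) (x y : ℝ) : ℝ :=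
  MvPolynomial.eval ![x, y] p

/-! On the hyperbola `x * y = 4 * w ^ 2`, `p(x, y) + p(y, x)` is a polynomial `Q` in `s = x + y` of
degree at most `d` (`exists_symm_poly`). The point `(2w, 2w)` gives `Q(4w) ≥ 4`; the lattice points
`(4w, w)` and `(w, 4w)` give `Q(5w) ≤ 2`. For `5w ≤ s ≤ N` the hyperbola stays in `L`. When `d ≤ w`,
interpolation from lattice points bounds `|Q|` there by `2 * exp (8 * d)`
(`abs_evalXY_le_of_int_bound`). Such a `Q` can drop by 2 over a step `w` next to this long interval
only if `N ≤ 7 * w * exp (10 * d)` (`abs_eval_sub_eval_left_le`). With `N ≥ 2 ^ (c * w)` this forces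
`d` to be linear in `w`. -/

open Finset Polynomial

/-! ### Newton interpolation bounds -/

/-- Newton's forward difference formula for a real polynomial. -/
lemma newton_forward_eval {g : ℝ[X]} {d : ℕ} (hg : g.natDegree ≤ d) (u : ℝ) :
    g.eval u = ∑ k ∈ range (d + 1),
      (descPochhammer ℝ k).eval u / k.factorial * (fwdDiff (1 : ℝ))^[k] (fun x => g.eval x) 0 := by
  set P : ℝ[X] := ∑ k ∈ range (d + 1),
    C ((fwdDiff (1 : ℝ))^[k] (fun x => g.eval x) 0 / k.factorial) * descPochhammer ℝ k with hP
  have hPd : P.natDegree ≤ d := by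
    refine natDegree_sum_le_of_forall_le _ _ fun k hk => ?_
    refine (natDegree_C_mul_le _ _).trans ?_
    rw [descPochhammer_natDegree]
    exact Nat.lt_succ_iff.mp (mem_range.mp hk)
  have hPe : ∀ v : ℝ, P.eval v = ∑ k ∈ range (d + 1),
      (descPochhammer ℝ k).eval v / k.factorial *
        (fwdDiff (1 : ℝ))^[k] (fun x => g.eval x) 0 := by
    intro v
    rw [hP, eval_finsetSum]
    refine sum_congr rfl fun k _ => ?_
    rw [eval_mul, eval_C]
    ring
  rw [← hPe]
  congr 1
  have hlt : ∀ {q : ℝ[X]}, q.natDegree ≤ d → q.degree < (range (d + 1)).card := by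
    intro q hq
    rw [card_range]
    exact (degree_le_of_natDegree_le hq).trans_lt (by exact_mod_cast Nat.lt_succ_self d)
  refine eq_of_degrees_lt_of_eval_index_eq (v := fun n : ℕ => (n : ℝ)) (range (d + 1))
    (fun _ _ _ _ h => Nat.cast_injective h) (hlt hg) (hlt hPd) fun n hn => ?_
  have h := shift_eq_sum_fwdDiff_iter (1 : ℝ) (fun x => g.eval x) n 0
  simp only [zero_add, nsmul_eq_mul, mul_one] at h
  rw [h, hPe]
  rw [sum_subset (range_subset_range.mpr (Nat.succ_le_of_lt (mem_range.mp hn)) :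
    range (n + 1) ⊆ range (d + 1))]
  · refine sum_congr rfl fun k _ => ?_
    rw [descPochhammer_eval_eq_descFactorial, Nat.descFactorial_eq_factorial_mul_choose]
    have : (k.factorial : ℝ) ≠ 0 := by exact_mod_cast k.factorial_ne_zero
    push_cast
    field_simp
  · intro k _ hk
    rw [Nat.choose_eq_zero_of_lt (by simpa using hk)]
    simp

lemma abs_fwdDiff_iter_le {f : ℝ → ℝ} {k : ℕ} {B : ℝ} (h : ∀ j : ℕ, j ≤ k → |f j| ≤ B) :
    |(fwdDiff (1 : ℝ))^[k] f 0| ≤ 2 ^ k * B := by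
  rw [fwdDiff_iter_eq_sum_shift]
  refine (abs_sum_le_sum_abs _ _).trans ?_
  have : (2 : ℝ) ^ k * B = ∑ j ∈ range (k + 1), (k.choose j : ℝ) * B := by
    rw [← sum_mul]
    congr 1
    exact_mod_cast (Nat.sum_range_choose k).symm
  rw [this]
  refine sum_le_sum fun j hj => ?_
  rw [zsmul_eq_mul, abs_mul]
  push_cast
  rw [abs_mul, abs_pow, abs_neg, abs_one, one_pow, one_mul, Nat.abs_cast]
  refine mul_le_mul_of_nonneg_left ?_ (Nat.cast_nonneg _)
  simpa using h j (Nat.lt_succ_iff.mp (mem_range.mp hj))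

/-- Each factor `u - j` has size at most `A` and each `k`-th difference at most `2 ^ k * B`, so the
Newton sum is dominated by the series of `exp (2 * A)`. -/
lemma abs_eval_le_of_nat_bound {g : ℝ[X]} {d : ℕ} (hg : g.natDegree ≤ d) {B : ℝ}
    (hB : ∀ j : ℕ, j ≤ d → |g.eval (j : ℝ)| ≤ B) {A u : ℝ} (hA : (d : ℝ) ≤ A)
    (hu : 0 ≤ u) (huA : u ≤ A) : |g.eval u| ≤ B * Real.exp (2 * A) := by
  have hB0 : 0 ≤ B := (abs_nonneg _).trans (hB 0 (Nat.zero_le _))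
  have hA0 : 0 ≤ A := hu.trans huA
  rw [newton_forward_eval hg u]
  refine (abs_sum_le_sum_abs _ _).trans ?_
  calc _ ≤ ∑ k ∈ range (d + 1), B * ((2 * A) ^ k / k.factorial) := by
        refine sum_le_sum fun k hk => ?_
        have hk' : k ≤ d := Nat.lt_succ_iff.mp (mem_range.mp hk)
        have h1 : |(descPochhammer ℝ k).eval u| ≤ A ^ k := by
          rw [descPochhammer_eval_eq_prod_range, abs_prod]
          calc _ ≤ ∏ _j ∈ range k, A := by
                refine prod_le_prod (fun _ _ => abs_nonneg _) fun j hj => ?_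
                have : (j : ℝ) ≤ d := by
                  exact_mod_cast ((mem_range.mp hj).le.trans hk')
                have : (0 : ℝ) ≤ j := Nat.cast_nonneg _
                rw [abs_le]
                constructor <;> linarith
            _ = A ^ k := by simp
        have h2 := abs_fwdDiff_iter_le (f := fun x => g.eval x) (k := k) (B := B)
          fun j hj => hB j (hj.trans hk')
        rw [abs_mul, abs_div, Nat.abs_cast]
        calc _ ≤ A ^ k / k.factorial * (2 ^ k * B) := by gcongr
          _ = B * ((2 * A) ^ k / k.factorial) := by rw [mul_pow]; ring
    _ ≤ B * Real.exp (2 * A) := by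
        rw [← mul_sum]
        exact mul_le_mul_of_nonneg_left (Real.sum_le_exp_of_nonneg (by positivity) _) hB0

/-- Every nonconstant Newton term contains the factor `u`. The other factors satisfy `|u - j| ≤ j +
1`, so the factorial cancels. -/
lemma abs_eval_sub_eval_zero_le {g : ℝ[X]} {d : ℕ} (hg : g.natDegree ≤ d) {B : ℝ}
    (hB : ∀ j : ℕ, j ≤ d → |g.eval (j : ℝ)| ≤ B) {u : ℝ} (hu : -1 ≤ u) (hu0 : u ≤ 0) :
    |g.eval u - g.eval 0| ≤ |u| * (2 ^ (d + 1) * B) := by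
  have hB0 : 0 ≤ B := (abs_nonneg _).trans (hB 0 (Nat.zero_le _))
  rw [newton_forward_eval hg u, sum_range_succ']
  simp only [descPochhammer_zero, eval_one, Nat.factorial_zero, Nat.cast_one, div_one, one_mul,
    Function.iterate_zero, id_eq, add_sub_cancel_right]
  refine (abs_sum_le_sum_abs _ _).trans ?_
  calc _ ≤ ∑ k ∈ range d, |u| * (2 ^ (k + 1) * B) := by
        refine sum_le_sum fun k hk => ?_
        have hk' : k + 1 ≤ d := mem_range.mp hk
        have h1 : |(descPochhammer ℝ (k + 1)).eval u| ≤ |u| * (k + 1).factorial := by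
          rw [descPochhammer_eval_eq_prod_range, abs_prod, prod_range_succ', mul_comm,
            ← prod_range_add_one_eq_factorial, prod_range_succ']
          push_cast
          rw [sub_zero]
          simp only [mul_one]
          refine mul_le_mul_of_nonneg_left ?_ (abs_nonneg _)
          refine prod_le_prod (fun _ _ => abs_nonneg _) fun j _ => ?_
          have : (0 : ℝ) ≤ j := Nat.cast_nonneg _
          rw [abs_le]
          constructor <;> linarith
        have h2 := abs_fwdDiff_iter_le (f := fun x => g.eval x) (k := k + 1) (B := B)
          fun j hj => hB j (hj.trans hk')
        have h3 : (0 : ℝ) < (k + 1).factorial := by exact_mod_cast Nat.factorial_pos _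
        rw [abs_mul, abs_div, Nat.abs_cast]
        exact mul_le_mul ((div_le_iff₀ h3).mpr h1) h2 (abs_nonneg _) (abs_nonneg _)
    _ = |u| * (B * ∑ k ∈ range d, 2 ^ (k + 1)) := by
        rw [mul_sum, mul_sum]
        exact sum_congr rfl fun k _ => by ring
    _ ≤ |u| * (2 ^ (d + 1) * B) := by
        refine mul_le_mul_of_nonneg_left ?_ (abs_nonneg _)
        rw [mul_comm]
        refine mul_le_mul_of_nonneg_right ?_ hB0
        have : ∀ n : ℕ, ∑ k ∈ range n, (2 : ℝ) ^ (k + 1) ≤ 2 ^ (n + 1) := by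
          intro n
          induction n with
          | zero => simp
          | succ n ih => rw [sum_range_succ, pow_succ 2 (n + 1)]; linarith
        exact this d

/-- A polynomial of degree at most `d` bounded by `B` at the integers of an interval of length at
least `d` is bounded by `B * exp (4 * d)` on the interval. -/
lemma abs_eval_le_of_int_bound {f : ℝ[X]} {d : ℕ} (hd : 1 ≤ d) (hf : f.natDegree ≤ d) {a L : ℤ}
    (hL : (d : ℤ) ≤ L) {B : ℝ} (hB : ∀ n : ℤ, a ≤ n → n ≤ a + L → |f.eval (n : ℝ)| ≤ B) {x : ℝ}
    (hx : (a : ℝ) ≤ x) (hxL : x ≤ a + L) : |f.eval x| ≤ B * Real.exp (4 * d) := by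
  -- Sampling at `a, a + m, ..., a + d * m` with `m = L / d` keeps the nodes in the interval and
  -- rescales its length to at most `2 * d`.
  obtain ⟨m, hm, hmL, hLm⟩ : ∃ m : ℤ, 1 ≤ m ∧ d * m ≤ L ∧ L ≤ 2 * d * m := by
    have hd0 : (0 : ℤ) < d := by exact_mod_cast hd
    have h1 : 1 ≤ L / d := (Int.le_ediv_iff_mul_le hd0).mpr (by simpa using hL)
    refine ⟨L / d, h1, Int.mul_ediv_self_le hd0.ne', ?_⟩
    have := Int.lt_mul_ediv_self_add (x := L) hd0
    nlinarith
  have hm0 : (0 : ℝ) < m := by exact_mod_cast (by lia : 0 < m)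
  have hLm' : (L : ℝ) ≤ 2 * d * m := by exact_mod_cast hLm
  have hdeg : (f.comp (C (m : ℝ) * X + C (a : ℝ))).natDegree ≤ d := by
    refine natDegree_comp_le.trans ((Nat.mul_le_mul hf natDegree_linear_le).trans ?_)
    simp
  have hdL : (d : ℝ) ≤ 2 * d := by linarith [(Nat.cast_nonneg d : (0 : ℝ) ≤ d)]
  have h := abs_eval_le_of_nat_bound hdeg (B := B) (A := 2 * d) (u := (x - a) / m) ?_ hdL
    (by apply div_nonneg <;> linarith) (by rw [div_le_iff₀ hm0]; linarith)
  · simp only [eval_comp, eval_add, eval_mul, eval_C, eval_X] at h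
    rw [mul_div_cancel₀ _ hm0.ne', sub_add_cancel] at h
    convert h using 3
    ring
  · intro j hj
    have hj' : (j : ℤ) ≤ d := by exact_mod_cast hj
    have := hB (m * j + a) (by nlinarith) (by nlinarith)
    simpa using this

/-- The restriction of a bivariate polynomial to a line `y = const`. -/
lemma exists_slice_fst (p : MvPolynomial (Fin 2) ℝ) (y : ℝ) :
    ∃ f : ℝ[X], f.natDegree ≤ p.totalDegree ∧ ∀ x, f.eval x = evalXY p x y := by
  refine ⟨MvPolynomial.aeval ![X, C y] p, ?_, fun x => ?_⟩
  · refine (MvPolynomial.aeval_natDegree_le p le_rfl _ (n := 1) fun i => ?_).trans (by simp)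
    fin_cases i <;> simp
  · rw [evalXY, ← coe_evalRingHom, MvPolynomial.aeval_def, MvPolynomial.hom_eval₂,
      MvPolynomial.eval, MvPolynomial.coe_eval₂Hom]
    congr 1
    · ext; simp
    · ext i; fin_cases i <;> simp

/-- The restriction of a bivariate polynomial to a line `x = const`. -/
lemma exists_slice_snd (p : MvPolynomial (Fin 2) ℝ) (x : ℝ) :
    ∃ f : ℝ[X], f.natDegree ≤ p.totalDegree ∧ ∀ y, f.eval y = evalXY p x y := by
  refine ⟨MvPolynomial.aeval ![C x, X] p, ?_, fun y => ?_⟩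
  · refine (MvPolynomial.aeval_natDegree_le p le_rfl _ (n := 1) fun i => ?_).trans (by simp)
    fin_cases i <;> simp
  · rw [evalXY, ← coe_evalRingHom, MvPolynomial.aeval_def, MvPolynomial.hom_eval₂,
      MvPolynomial.eval, MvPolynomial.coe_eval₂Hom]
    congr 1
    · ext; simp
    · ext i; fin_cases i <;> simp

/-- On a lattice rectangle with both sides of length at least the degree, boundedness at the lattice
points gives an exponential bound on the whole rectangle. -/
lemma abs_evalXY_le_of_int_bound {p : MvPolynomial (Fin 2) ℝ} {d : ℕ} (hd : 1 ≤ d)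
    (hp : p.totalDegree ≤ d) {a b L M : ℤ} (hL : (d : ℤ) ≤ L) (hM : (d : ℤ) ≤ M) {B : ℝ}
    (hB : ∀ m n : ℤ, a ≤ m → m ≤ a + L → b ≤ n → n ≤ b + M → |evalXY p m n| ≤ B) {x y : ℝ}
    (hx : (a : ℝ) ≤ x) (hxL : x ≤ a + L) (hy : (b : ℝ) ≤ y) (hyM : y ≤ b + M) :
    |evalXY p x y| ≤ B * Real.exp (8 * d) := by
  obtain ⟨f, hf, hfe⟩ := exists_slice_snd p x
  have h := abs_eval_le_of_int_bound (B := B * Real.exp (4 * d)) hd (hf.trans hp) hM ?_ hy hyM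
  · rw [hfe, mul_assoc, ← Real.exp_add] at h
    convert h using 3
    ring
  · intro n hn hn'
    obtain ⟨g, hg, hge⟩ := exists_slice_fst p n
    rw [hfe, ← hge]
    refine abs_eval_le_of_int_bound hd (hg.trans hp) hL (fun m hm hm' => ?_) hx hxL
    rw [hge]
    exact hB m n hm hm' hn hn'

/-! ### Symmetrization on a hyperbola -/

/-- Power sums of `x, y` are polynomials in `x + y` when `x * y` is fixed. -/
lemma exists_powerSum_poly (k : ℝ) (n : ℕ) :
    ∃ T : ℝ[X], T.natDegree ≤ n ∧ ∀ x y, x * y = k → T.eval (x + y) = x ^ n + y ^ n := by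
  induction n using Nat.twoStepInduction with
  | zero => exact ⟨C 2, by simp, fun x y _ => by simp; norm_num⟩
  | one => exact ⟨X, by simp, fun x y _ => by simp⟩
  | more n ih₁ ih₂ =>
    obtain ⟨T₁, hd₁, he₁⟩ := ih₁
    obtain ⟨T₂, hd₂, he₂⟩ := ih₂
    -- Newton's recurrence: multiply the power sum of order `n + 1` by `x + y` and subtract `x * y`
    -- times that of order `n`.
    refine ⟨X * T₂ - C k * T₁, ?_, fun x y hxy => ?_⟩
    · refine natDegree_sub_le_of_le (m := n + 2) (n := n + 2) ?_
        ((natDegree_C_mul_le _ _).trans (hd₁.trans (by lia))) |>.trans (by simp)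
      refine natDegree_mul_le.trans ?_
      rw [natDegree_X]
      lia
    · simp only [eval_sub, eval_mul, eval_X, eval_C, he₁ x y hxy, he₂ x y hxy, ← hxy]
      ring

lemma exists_symm_monomial_poly (k : ℝ) (a b : ℕ) :
    ∃ T : ℝ[X], T.natDegree ≤ a + b ∧
      ∀ x y, x * y = k → T.eval (x + y) = x ^ a * y ^ b + y ^ a * x ^ b := by
  wlog hab : a ≤ b generalizing a b
  · obtain ⟨T, hT, hTe⟩ := this b a (le_of_not_ge hab)
    exact ⟨T, by lia, fun x y h => by rw [hTe x y h]; ring⟩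
  obtain ⟨n, rfl⟩ := Nat.exists_eq_add_of_le hab
  obtain ⟨T, hT, hTe⟩ := exists_powerSum_poly k n
  refine ⟨C (k ^ a) * T, (natDegree_C_mul_le _ _).trans (by lia), fun x y hxy => ?_⟩
  rw [eval_mul, eval_C, hTe x y hxy, ← hxy]
  ring

/-- On the hyperbola `x * y = k`, the symmetrization of `p` is a polynomial in `x + y`. -/
lemma exists_symm_poly (p : MvPolynomial (Fin 2) ℝ) (k : ℝ) :
    ∃ Q : ℝ[X], Q.natDegree ≤ p.totalDegree ∧
      ∀ x y, x * y = k → Q.eval (x + y) = evalXY p x y + evalXY p y x := by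
  choose T hT hTe using exists_symm_monomial_poly k
  refine ⟨∑ m ∈ p.support, C (p.coeff m) * T (m 0) (m 1), ?_, fun x y hxy => ?_⟩
  · refine natDegree_sum_le_of_forall_le _ _ fun m hm => ?_
    refine (natDegree_C_mul_le _ _).trans ((hT _ _).trans ?_)
    have h := MvPolynomial.le_totalDegree hm
    rwa [Finsupp.sum_fintype _ _ (fun _ => rfl), Fin.sum_univ_two] at h
  · rw [eval_finsetSum, evalXY, evalXY, MvPolynomial.eval_eq', MvPolynomial.eval_eq',
      ← sum_add_distrib]
    refine sum_congr rfl fun m _ => ?_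
    simp only [eval_mul, eval_C, hTe _ _ x y hxy, Fin.prod_univ_two, Matrix.cons_val_zero,
      Matrix.cons_val_one]
    ring

/-- `x` and `y` are the roots of `t ^ 2 - s * t + 4 * w ^ 2`. The smaller root decreases in `s` and
equals `w` at `s = 5 * w`. -/
lemma exists_hyperbola_point {w s : ℝ} (hw : 0 < w) (hs : 5 * w ≤ s) :
    ∃ x y : ℝ, x * y = 4 * w ^ 2 ∧ x + y = s ∧ 2 * w ≤ x ∧ x ≤ s ∧ 0 ≤ y ∧ y ≤ w := by
  have hr : 3 * w ≤ √(s ^ 2 - 16 * w ^ 2) := Real.le_sqrt_of_sq_le (by nlinarith)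
  have hsq : √(s ^ 2 - 16 * w ^ 2) ^ 2 = s ^ 2 - 16 * w ^ 2 := Real.sq_sqrt (by nlinarith)
  set r := √(s ^ 2 - 16 * w ^ 2)
  have hrs : r ≤ s := by nlinarith
  refine ⟨(s + r) / 2, (s - r) / 2, by nlinarith, by ring, by linarith, by linarith,
    by linarith, ?_⟩
  nlinarith

/-- A polynomial bounded by `B` on `[a, b]` changes little just to the left of `a`. -/
lemma abs_eval_sub_eval_left_le {f : ℝ[X]} {d : ℕ} (hd : 1 ≤ d) (hf : f.natDegree ≤ d)
    {a b B v : ℝ} (hB : ∀ x, a ≤ x → x ≤ b → |f.eval x| ≤ B) (hv : 0 ≤ v)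
    (hab : a < b) (hvd : v * d ≤ b - a) :
    |f.eval (a - v) - f.eval a| ≤ v * d / (b - a) * (2 ^ (d + 1) * B) := by
  have hd0 : (0 : ℝ) < d := by exact_mod_cast hd
  have hba : 0 < b - a := sub_pos.mpr hab
  -- Rescaling `[a, b]` to `[0, d]` sends `a - v` to `-(v * d / (b - a))`, which lies in `[-1, 0]`.
  have hdeg : (f.comp (C ((b - a) / d) * X + C a)).natDegree ≤ d := by
    refine natDegree_comp_le.trans ((Nat.mul_le_mul hf natDegree_linear_le).trans ?_)
    simp
  have h1 : v * d / (b - a) ≤ 1 := (div_le_one hba).mpr hvd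
  have h0 : 0 ≤ v * d / (b - a) := by positivity
  have h := abs_eval_sub_eval_zero_le hdeg (B := B) (u := -(v * d / (b - a))) ?_
    (by linarith) (by linarith)
  · simp only [eval_comp, eval_add, eval_mul, eval_C, eval_X, abs_neg, abs_of_nonneg h0, mul_zero,
      zero_add] at h
    convert h using 4
    congr 1
    field_simp
    ring
  · intro j hj
    have hj' : (j : ℝ) ≤ d := by exact_mod_cast hj
    have hj0 : (0 : ℝ) ≤ j := Nat.cast_nonneg _
    simp only [eval_comp, eval_add, eval_mul, eval_C, eval_X]
    apply hB
    · have : 0 ≤ (b - a) / d * j := by positivity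
      linarith
    · have : (b - a) / d * j ≤ b - a := by
        rw [div_mul_eq_mul_div, div_le_iff₀ hd0]
        gcongr
      linarith

lemma intCast_mem_regionL_left {w N m n : ℤ} (hm : 2 * w ≤ m) (hmN : m ≤ N) (hn : 0 ≤ n)
    (hnw : n ≤ w) : ((m : ℝ), (n : ℝ)) ∈ regionL (w : ℝ) (N : ℝ) := by
  simp only [regionL, rectX, Set.mem_union, Set.mem_prod, Set.mem_Icc]
  exact Or.inl ⟨⟨by exact_mod_cast hm, by exact_mod_cast hmN⟩, by exact_mod_cast hn,
    by exact_mod_cast hnw⟩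

lemma intCast_mem_regionL_right {w N m n : ℤ} (hm : 0 ≤ m) (hmw : m ≤ w) (hn : 2 * w ≤ n)
    (hnN : n ≤ N) : ((m : ℝ), (n : ℝ)) ∈ regionL (w : ℝ) (N : ℝ) := by
  simp only [regionL, rectY, Set.mem_union, Set.mem_prod, Set.mem_Icc]
  exact Or.inr ⟨⟨by exact_mod_cast hm, by exact_mod_cast hmw⟩, by exact_mod_cast hn,
    by exact_mod_cast hnN⟩

/-- If `p` satisfies the hypotheses on the L-shaped region and has degree `d ≤ w`, then `N` is at
most `7 * w * exp (10 * d)`. -/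
lemma le_exp_of_bounded_on_regionL {w N : ℤ} (hw : 0 < w) {p : MvPolynomial (Fin 2) ℝ}
    (hd : 1 ≤ p.totalDegree) (hdw : (p.totalDegree : ℤ) ≤ w)
    (h2 : 2 ≤ evalXY p (2 * (w : ℝ)) (2 * (w : ℝ)))
    (hL : ∀ x y : ℤ, ((x : ℝ), (y : ℝ)) ∈ regionL (w : ℝ) (N : ℝ) →
      0 ≤ evalXY p (x : ℝ) (y : ℝ) ∧ evalXY p (x : ℝ) (y : ℝ) ≤ 1) :
    (N : ℝ) ≤ 7 * w * Real.exp (10 * p.totalDegree) := by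
  by_contra! hN
  set d := p.totalDegree with hdef
  have hw0 : (0 : ℝ) < w := by exact_mod_cast hw
  have hd0 : (1 : ℝ) ≤ d := by exact_mod_cast hd
  have hexp1 : 1 ≤ Real.exp (10 * d) := Real.one_le_exp (by positivity)
  have h7 : (7 * w : ℝ) < N := by nlinarith
  have h7' : 7 * w < N := by exact_mod_cast h7
  have hX : ∀ m n : ℤ, 2 * w ≤ m → m ≤ 2 * w + (N - 2 * w) → 0 ≤ n → n ≤ 0 + w →
      evalXY p m n ≤ 1 ∧ |evalXY p m n| ≤ 1 := by
    intro m n hm hm' hn hn'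
    obtain ⟨h0, h1⟩ := hL m n (intCast_mem_regionL_left hm (by lia) hn (by lia))
    exact ⟨h1, by rwa [abs_of_nonneg h0]⟩
  have hY : ∀ m n : ℤ, 0 ≤ m → m ≤ 0 + w → 2 * w ≤ n → n ≤ 2 * w + (N - 2 * w) →
      evalXY p m n ≤ 1 ∧ |evalXY p m n| ≤ 1 := by
    intro m n hm hm' hn hn'
    obtain ⟨h0, h1⟩ := hL m n (intCast_mem_regionL_right hm (by lia) hn (by lia))
    exact ⟨h1, by rwa [abs_of_nonneg h0]⟩
  obtain ⟨Q, hQd, hQ⟩ := exists_symm_poly p (4 * (w : ℝ) ^ 2)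
  have hQ4 : 4 ≤ Q.eval (5 * w - w : ℝ) := by
    have := hQ (2 * w) (2 * w) (by ring)
    rw [show (5 * w - w : ℝ) = 2 * w + 2 * w by ring, this]
    linarith
  have hQ5 : Q.eval (5 * w : ℝ) ≤ 2 := by
    have := hQ (4 * w) w (by ring)
    rw [show (5 * w : ℝ) = 4 * w + w by ring, this]
    have h1 := (hX (4 * w) w (by lia) (by lia) (by lia) (by lia)).1
    have h2 := (hY w (4 * w) (by lia) (by lia) (by lia) (by lia)).1
    push_cast at h1 h2
    linarith
  have hQB : ∀ s : ℝ, 5 * w ≤ s → s ≤ N → |Q.eval s| ≤ 2 * Real.exp (8 * d) := by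
    intro s hs hsN
    obtain ⟨x, y, hxy, rfl, hx, hxs, hy, hyw⟩ := exists_hyperbola_point hw0 hs
    rw [hQ x y hxy]
    have h1 := abs_evalXY_le_of_int_bound hd hdef.ge (by lia) hdw
      (fun m n a b c e => (hX m n a b c e).2) (x := x) (y := y) (by push_cast; linarith)
      (by push_cast; linarith) (by push_cast; linarith) (by push_cast; linarith)
    have h2 := abs_evalXY_le_of_int_bound hd hdef.ge hdw (by lia)
      (fun m n a b c e => (hY m n a b c e).2) (x := y) (y := x) (by push_cast; linarith)
      (by push_cast; linarith) (by push_cast; linarith) (by push_cast; linarith)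
    refine (abs_add_le _ _).trans ?_
    linarith
  have hd2 : (d : ℝ) * 2 ^ d ≤ Real.exp (2 * d) := by
    have h1 : (d : ℝ) ≤ Real.exp d := by linarith [Real.add_one_le_exp (d : ℝ)]
    have h2 : (2 : ℝ) ^ d ≤ Real.exp d := by
      rw [← Real.exp_one_pow]
      gcongr
      linarith [Real.add_one_le_exp (1 : ℝ)]
    rw [two_mul, Real.exp_add]
    gcongr
  have hd8 : (d : ℝ) * 2 ^ d * Real.exp (8 * d) ≤ Real.exp (10 * d) := by
    rw [show (10 * d : ℝ) = 2 * d + 8 * d by ring, Real.exp_add]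
    gcongr
  -- The 7 splits as 5 + 2: since the exponential is at least 1, `5 * w` is absorbed.
  have hgap : 2 * w * Real.exp (10 * d) < N - 5 * w := by nlinarith
  have hdexp : (d : ℝ) ≤ Real.exp (10 * d) := by linarith [Real.add_one_le_exp (10 * d : ℝ)]
  have hmain := abs_eval_sub_eval_left_le hd hQd hQB hw0.le (by linarith)
    (by nlinarith [mul_le_mul_of_nonneg_left hdexp hw0.le])
  have hlt : (w : ℝ) * d / (N - 5 * w) * (2 ^ (d + 1) * (2 * Real.exp (8 * d))) < 2 := by
    rw [div_mul_eq_mul_div, div_lt_iff₀ (by linarith)]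
    calc _ = 4 * w * ((d : ℝ) * 2 ^ d * Real.exp (8 * d)) := by ring
      _ ≤ 4 * w * Real.exp (10 * d) := by gcongr
      _ < 2 * (N - 5 * w) := by linarith
  linarith [le_abs_self (Q.eval (5 * w - w : ℝ) - Q.eval (5 * w : ℝ))]

theorem theorem3p3 (c : ℝ) (hc : 0 < c) :
    ∃ δ : ℝ, 0 < δ ∧ ∀ w N : ℤ, 0 < w → 2 * w ≤ N → (2 : ℝ) ^ (c * (w : ℝ)) ≤ (N : ℝ) →
      ∀ p : MvPolynomial (Fin 2) ℝ,
        2 ≤ evalXY p (2 * (w : ℝ)) (2 * (w : ℝ)) →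
        (∀ x y : ℤ, ((x : ℝ), (y : ℝ)) ∈ regionL (w : ℝ) (N : ℝ) →
          0 ≤ evalXY p (x : ℝ) (y : ℝ) ∧ evalXY p (x : ℝ) (y : ℝ) ≤ 1) →
        δ * (w : ℝ) ≤ (p.totalDegree : ℝ) := by
  set c' : ℝ := Real.log 2 * c with hc'
  have hc0 : 0 < c' := mul_pos (Real.log_pos (by norm_num)) hc
  -- Assuming `d < δ * w`, the three entries give `d ≤ w`, then `10 * d ≤ c' * w / 2`, and, since `d
  -- ≥ 1`, `56 ≤ c' ^ 2 * w`. The last contradicts `exp (c' * w / 2) ≤ 7 * w` through `1 + t + t ^ 2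
  -- / 2 ≤ exp t`.
  refine ⟨min 1 (min (c' / 20) (c' ^ 2 / 56)), by positivity, ?_⟩
  intro w N hw hwN hN p h2 hL
  by_contra! hlt
  set δ : ℝ := min 1 (min (c' / 20) (c' ^ 2 / 56)) with hδ
  have hw0 : (0 : ℝ) < w := by exact_mod_cast hw
  have hδ1 : δ ≤ 1 := min_le_left _ _
  have hδ2 : δ ≤ c' / 20 := (min_le_right _ _).trans (min_le_left _ _)
  have hδ3 : δ ≤ c' ^ 2 / 56 := (min_le_right _ _).trans (min_le_right _ _)
  -- A constant cannot be at least 2 at `(2w, 2w)` and at most 1 at `(2w, 0)`.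
  have hd : 1 ≤ p.totalDegree := by
    by_contra! h0
    obtain ⟨a, rfl⟩ : ∃ a, p = MvPolynomial.C a :=
      ⟨_, MvPolynomial.totalDegree_eq_zero_iff_eq_C.mp (Nat.lt_one_iff.mp h0)⟩
    have h1 := (hL (2 * w) 0 (intCast_mem_regionL_left le_rfl hwN le_rfl hw.le)).2
    simp only [evalXY, MvPolynomial.eval_C] at h1 h2
    linarith
  have hd0 : (1 : ℝ) ≤ p.totalDegree := by exact_mod_cast hd
  have hdw : (p.totalDegree : ℤ) ≤ w := by
    have : (p.totalDegree : ℝ) ≤ w := by nlinarith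
    exact_mod_cast this
  have hle := hN.trans (le_exp_of_bounded_on_regionL hw hd hdw h2 hL)
  rw [Real.rpow_def_of_pos (by norm_num), ← mul_assoc, ← hc'] at hle
  have h10 : Real.exp (10 * p.totalDegree) ≤ Real.exp (c' * w / 2) := by
    apply Real.exp_le_exp.mpr
    nlinarith
  have hsplit : Real.exp (c' * w) = Real.exp (c' * w / 2) * Real.exp (c' * w / 2) := by
    rw [← Real.exp_add]
    ring_nf
  have hpos := Real.exp_pos (c' * w / 2)
  have h7 : Real.exp (c' * w / 2) ≤ 7 * w := by
    refine le_of_mul_le_mul_right ?_ hpos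
    rw [← hsplit]
    exact hle.trans (by gcongr)
  have hquad := Real.quadratic_le_exp_of_nonneg (x := c' * w / 2) (by positivity)
  have hcw : 56 ≤ c' ^ 2 * w := by nlinarith
  have : 0 ≤ c' * w / 2 := by positivity
  nlinarith
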